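/- Let $k\ge 1$. The Johnson graph $J(2k,k,1)$ has as vertices the $k$-subsets of a $2k$-element set, two being adjacent when they differ in exactly one element (that is, their intersection has $k-1$ elements). For $1\le r\le k$ let $A_r$ be the adjacency matrix of its distance-$r$ graph. Let $w_1,\dots,w_k\in\{0,1\}$ and let $X$ be the graph with adjacency matrix $A=\sum_{r=1}^k w_rA_r$. Put $U(t)=\exp(-itA)$ for real $t$. We say that $X$ has perfect state transfer at time $t$ if $|U(t)_{a,b}|=1$ for some two distinct vertices $a\ne b$, and that $X$ has perfect state transfer if this happens for some $t>0$. Let $\sigma_2(j)$ be the sum of the binary digits of $j$. For an integer $h\ge1$, let $C(h)$ be the following condition: there are integers $v_1,\dots,v_k$ such that $$w_r\equiv\sum_{j=r}^k v_j\binom{k-r}{j-r}\pmod{2^h}\qquad(r=1,\dots,k),$$ where, for each $j=1,\dots,k$, $v_j\equiv 2^{h-1}\pmod{2^h}$ if $\sigma_2(j)=1$, and $v_j\equiv0\pmod{2^{h+1-\sigma_2(j)}}$ if $2\le\sigma_2(j)\le h$ (there is no condition on $v_j$ if $\sigma_2(j)>h$). Then $X$ has perfect state transfer if and only if $C(h)$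 holds for some integer $h\ge1$. Moreover, whenever $h\ge1$ and $C(h)$ holds, $X$ has perfect state transfer at time $\pi/2^h$, and there is an odd integer $z\ge1$ such that the real times at which $X$ has perfect state transfer are exactly the odd integer multiples of $\pi/(2^hz)$. (So if $z\ge3$, perfect state transfer also occurs at the earlier time $\pi/(2^hz)$.) -/

import Mathlib

/-- The Johnson graph `J(n,k,1)`: its vertices are the `k`-subsets of an `n`-set, and two of them
are adjacent when they differ in exactly one element. -/
def johnsonGraph (n k : ℕ) : SimpleGraph {s : Finset (Fin n) // s.card = k} where
  Adj s t := (s.1 \ t.1).card = 1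
  symm := ⟨fun s t h => by
    rw [Finset.card_sdiff_comm (t.2.trans s.2.symm)]
    exact h⟩
  loopless := ⟨fun s h => by simp at h⟩

/-- The distance-`r` graph of `G`: distinct vertices are adjacent when their distance in `G`
(which is infinite between different components) is `r`. -/
def distanceGraph {V : Type*} (G : SimpleGraph V) (r : ℕ) : SimpleGraph V where
  Adj u v := u ≠ v ∧ G.edist u v = r
  symm := ⟨fun u v h => ⟨h.1.symm, by rw [SimpleGraph.edist_comm]; exact h.2⟩⟩
  loopless := ⟨fun _ h => h.1 rfl⟩

noncomputable instance distanceGraph.decidableAdj {V : Type*} (G : SimpleGraph V) (r : ℕ) :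
    DecidableRel (distanceGraph G r).Adj :=
  Classical.decRel _

/-- The generalized Johnson graph `J(n,k,r)`. -/
abbrev generalizedJohnsonGraph (n k r : ℕ) : SimpleGraph {s : Finset (Fin n) // s.card = k} :=
  distanceGraph (johnsonGraph n k) r

/-- The transition matrix `U(t) = exp(-itA)` of the continuous-time quantum walk on a graph `X`
with adjacency matrix `A`. -/
noncomputable def transitionMatrix {V : Type*} [Fintype V] [DecidableEq V] (X : SimpleGraph V)
    [DecidableRel X.Adj] (t : ℝ) : Matrix V V ℂ :=
  NormedSpace.exp ((-(Complex.I * (t : ℂ))) • X.adjMatrix ℂ)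

/-- `X` has perfect state transfer at time `t`: it occurs between some two distinct vertices. -/
def HasPSTAt {V : Type*} [Fintype V] [DecidableEq V] (X : SimpleGraph V)
    [DecidableRel X.Adj] (t : ℝ) : Prop :=
  ∃ u v : V, u ≠ v ∧ ‖transitionMatrix X t u v‖ = 1

/-- `X` has perfect state transfer (at some positive time). -/
def HasPST {V : Type*} [Fintype V] [DecidableEq V] (X : SimpleGraph V)
    [DecidableRel X.Adj] : Prop :=
  ∃ t : ℝ, 0 < t ∧ HasPSTAt X t

/-- The sum `σ₂(n)` of the binary digits of `n`. -/
def binaryDigitSum (n : ℕ) : ℕ := (Nat.digits 2 n).sum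

/-- The congruence condition on the weights `w 1, …, w k` with parameter `h`. The binomial
coefficient `C(k - r, j - r)` is zero for `j < r`, so the sum over `j` starts at `j = r`. -/
def WeightCondition (k : ℕ) (w : ℕ → ℤ) (h : ℕ) : Prop :=
  ∃ v : ℕ → ℤ,
    (∀ j ∈ Finset.Icc 1 k,
      (binaryDigitSum j = 1 → v j ≡ 2 ^ (h - 1) [ZMOD 2 ^ h]) ∧
      (2 ≤ binaryDigitSum j → binaryDigitSum j ≤ h →
        v j ≡ 0 [ZMOD 2 ^ (h + 1 - binaryDigitSum j)])) ∧
    ∀ r ∈ Finset.Icc 1 k,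
      w r ≡ ∑ j ∈ Finset.Icc r k, v j * ((k - r).choose (j - r) : ℤ) [ZMOD 2 ^ h]

/-! ### 2-adic arithmetic of the eigenvalues. -/

section Arithmetic

open Finset

/-! The adjacency matrix `A` lies in the Johnson scheme, spanned by the matrices `inclusionGram k
j`. Binomial inversion of the weights writes `A` as `∑ v j • inclusionGram k j` minus a scalar
matrix, so its eigenvalues are, up to that scalar, `f(m) = ∑ v j * C(m,j) * C(m+j,j)` for `m = 0, …,
k`, with `f(0) = 0`.

Entries of `U(t)` depend only on the intersection size and its rows are unit vectors, so an
off-diagonal entry of modulus one can only join complementary sets, and `U(t)` is then a unimodular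
multiple of the antipodal matrix (`hasPSTAt_iff_antipodal`). That matrix has eigenvalues
`(-1)^(k+m)`. Hence transfer at time `t` means that `(t/π) f(m)` is an integer congruent to `m` mod
2 for every `m ≤ k` (`hasPSTAt_iff_phase`).

By Bézout, such a `t` exists iff `f(m) ≡ 2^h m` mod `2^(h+1)` for some `h`; the admissible `t` are
then the odd multiples of `π/g`, where `g = 2^h z` is the gcd of the `f(m)` and `z` is odd.

Finally `C(m,j) C(m+j,j) = C(2j,j) C(m+j,2j)`. The matrix `C(m+j,2j)` is unitriangular, and mod 2 it
sends the indicator of the powers of 2 to the vector `m`, so the congruences decouple into one for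
each `v j * C(2j,j)`. Kummer's theorem gives `C(2j,j)` the 2-adic valuation `σ₂(j)`, which turns
them into `WeightCondition` (`weightCondition_iff`). -/

theorem binaryDigitSum_two_mul (j : ℕ) : binaryDigitSum (2 * j) = binaryDigitSum j := by
  rcases Nat.eq_zero_or_pos j with rfl | hj
  · simp
  · unfold binaryDigitSum
    rw [Nat.digits_base_mul (by norm_num) hj]
    simp

theorem binaryDigitSum_two_mul_add_one (j : ℕ) :
    binaryDigitSum (2 * j + 1) = binaryDigitSum j + 1 := by
  unfold binaryDigitSum
  rw [Nat.digits_def' (by norm_num) (by omega), show (2 * j + 1) % 2 = 1 by omega,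
    show (2 * j + 1) / 2 = j by omega, List.sum_cons, add_comm]

theorem binaryDigitSum_eq_zero {j : ℕ} : binaryDigitSum j = 0 ↔ j = 0 := by
  constructor
  · intro h
    induction j using Nat.strong_induction_on with
    | _ j ih =>
      rcases Nat.even_or_odd' j with ⟨i, rfl | rfl⟩
      · rw [binaryDigitSum_two_mul] at h
        by_contra hne
        exact hne (by rw [ih i (by omega) h])
      · rw [binaryDigitSum_two_mul_add_one] at h
        omega
  · rintro rfl
    simp [binaryDigitSum]

/-- Kummer's theorem for the central binomial coefficients at the prime `2`. -/
theorem exists_odd_choose_two_mul (j : ℕ) :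
    ∃ q : ℕ, Odd q ∧ (2 * j).choose j = 2 ^ binaryDigitSum j * q := by
  have hval : padicValNat 2 ((2 * j).choose j) = binaryDigitSum j := by
    have h := sub_one_mul_padicValNat_choose_eq_sub_sum_digits' (p := 2) (k := j) (n := j)
    have h2 := binaryDigitSum_two_mul j
    rw [← two_mul] at h
    unfold binaryDigitSum at *
    omega
  have hpos : (2 * j).choose j ≠ 0 := (Nat.choose_pos (by omega)).ne'
  obtain ⟨e, q, hq, he⟩ := Nat.exists_eq_two_pow_mul_odd hpos
  refine ⟨q, hq, ?_⟩
  rw [← hval, he]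
  congr 2
  rw [padicValNat.mul (by positivity) (by rintro rfl; simp at hq), padicValNat.prime_pow,
    padicValNat.eq_zero_of_not_dvd hq.not_two_dvd_nat, add_zero]

/-- Separates the factor carrying the powers of 2, `C(2j,j)`, from the unitriangular one. -/
theorem choose_mul_choose_add (m j : ℕ) :
    m.choose j * (m + j).choose j = (2 * j).choose j * (m + j).choose (2 * j) := by
  have h := Nat.choose_mul (n := m + j) (k := 2 * j) (s := j) (by omega)
  rw [Nat.add_sub_cancel, show 2 * j - j = j by omega] at h
  rw [mul_comm, ← h, mul_comm]

theorem choose_four_mul_modEq (m i : ℕ) :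
    ((m + 2 * i).choose (2 * (2 * i)) : ℤ) ≡ ((m / 2 + i).choose (2 * i) : ℤ) [ZMOD 2] := by
  have h := Choose.choose_modEq_choose_mod_mul_choose_div (p := 2) (n := m + 2 * i)
    (k := 2 * (2 * i))
  rw [show (m + 2 * i) / 2 = m / 2 + i by omega, show 2 * (2 * i) % 2 = 0 by omega,
    show 2 * (2 * i) / 2 = 2 * i by omega] at h
  simpa using h

theorem choose_two_modEq (m : ℕ) :
    ((m + 1).choose 2 : ℤ) ≡ ((m + 1) / 2 : ℕ) [ZMOD 2] := by
  have h := Choose.choose_modEq_choose_mod_mul_choose_div (p := 2) (n := m + 1) (k := 2)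
  simpa using h

theorem sum_range_two_mul {M : Type*} [AddCommMonoid M] (g : ℕ → M) (n : ℕ) :
    ∑ j ∈ range (2 * n), g j = ∑ j ∈ range n, (g (2 * j) + g (2 * j + 1)) := by
  induction n with
  | zero => simp
  | succ n ih =>
    rw [show 2 * (n + 1) = 2 * n + 1 + 1 by ring, sum_range_succ, sum_range_succ, ih,
      sum_range_succ, add_assoc]

/-- Modulo `2`, the binomial coefficients `C(m + j, 2j)` with `j` a power of `2` add up to `m`. -/
theorem sum_choose_binaryDigitSum_eq_one (m : ℕ) : ∀ n : ℕ, m < n →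
    ∑ j ∈ range n, (if binaryDigitSum j = 1 then ((m + j).choose (2 * j) : ℤ) else 0)
      ≡ m [ZMOD 2] := by
  induction m using Nat.strong_induction_on with
  | _ m ih =>
    intro n hn
    rcases Nat.eq_zero_or_pos m with rfl | hm
    · rw [sum_eq_zero]
      · rfl
      · intro j _
        split_ifs with h
        · rw [Nat.choose_eq_zero_of_lt, Nat.cast_zero]
          have : j ≠ 0 := by
            rintro rfl
            simp [binaryDigitSum] at h
          omega
        · rfl
    -- The added terms vanish because `m < j`; doubling the range allows a split by the parity of
    -- `j`.
    have hext : ∑ j ∈ range n, (if binaryDigitSum j = 1 then ((m + j).choose (2 * j) : ℤ) else 0)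
        = ∑ j ∈ range (2 * n),
          (if binaryDigitSum j = 1 then ((m + j).choose (2 * j) : ℤ) else 0) := by
      refine sum_subset (range_mono (by omega)) fun j _ hj => ?_
      rw [mem_range] at hj
      rw [Nat.choose_eq_zero_of_lt (by omega)]
      simp
    rw [hext, sum_range_two_mul, sum_add_distrib]
    -- By Lucas, the even indices reproduce the same sum for `m / 2`.
    have heven : ∑ j ∈ range n, (if binaryDigitSum (2 * j) = 1 then
        ((m + 2 * j).choose (2 * (2 * j)) : ℤ) else 0) ≡ (m / 2 : ℕ) [ZMOD 2] := by
      refine Int.ModEq.trans ?_ (ih (m / 2) (by omega) n (by omega))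
      refine Int.ModEq.sum fun j _ => ?_
      rw [binaryDigitSum_two_mul]
      split_ifs
      · exact choose_four_mul_modEq m j
      · rfl
    -- The only odd power of 2 is 1.
    have hodd : ∑ j ∈ range n, (if binaryDigitSum (2 * j + 1) = 1 then
        ((m + (2 * j + 1)).choose (2 * (2 * j + 1)) : ℤ) else 0) ≡ ((m + 1) / 2 : ℕ) [ZMOD 2] := by
      rw [sum_eq_single_of_mem 0 (mem_range.2 (by omega))]
      · simpa [binaryDigitSum] using choose_two_modEq m
      · intro j _ hj
        rw [binaryDigitSum_two_mul_add_one, if_neg]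
        have := binaryDigitSum_eq_zero.not.2 hj
        omega
    refine (heven.add hodd).trans ?_
    rw [← Nat.cast_add, show m / 2 + (m + 1) / 2 = m by omega]

/-- Forward substitution, valid modulo any `N` because the diagonal entries are 1. -/
theorem dvd_of_unitriangular {N : ℤ} {n : ℕ} (a : ℕ → ℕ → ℤ) (d : ℕ → ℤ) (ha : ∀ p, a p p = 1)
    (h : ∀ p < n, N ∣ ∑ i ∈ range (p + 1), a p i * d i) : ∀ p < n, N ∣ d p := by
  intro p
  induction p using Nat.strong_induction_on with
  | _ p ih =>
    intro hp
    have h1 := h p hp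
    rw [sum_range_succ, ha, one_mul] at h1
    refine (Int.dvd_iff_dvd_of_dvd_add h1).1 (dvd_sum fun i hi => ?_)
    rw [mem_range] at hi
    exact (ih i hi (by omega)).mul_left _

/-- The eigenvalues of `X` are the values of this function, up to a common shift. -/
def eigenvalueShift (k : ℕ) (v : ℕ → ℤ) (m : ℕ) : ℤ :=
  ∑ j ∈ Icc 1 k, v j * ((m.choose j : ℤ) * ((m + j).choose j : ℤ))

theorem eigenvalueShift_eq (k : ℕ) (v : ℕ → ℤ) {m : ℕ} :
    eigenvalueShift k v m =
      ∑ j ∈ Icc 1 k, ((m + j).choose (2 * j) : ℤ) * (v j * ((2 * j).choose j : ℤ)) := by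
  refine sum_congr rfl fun j _ => ?_
  have := choose_mul_choose_add m j
  rw [← Nat.cast_mul, this]
  push_cast
  ring

theorem sum_Icc_one_eq_sum_range {M : Type*} [AddCommMonoid M] (k : ℕ) (g : ℕ → M) :
    ∑ j ∈ Icc 1 k, g j = ∑ i ∈ range k, g (i + 1) := by
  rw [range_eq_Ico, sum_Ico_add' g 0 k 1]
  rfl

/-- The congruences on the eigenvalues determine the coefficients, since the binomial matrix
`C(m + j, 2j)` is unitriangular. -/
theorem eigenvalueShift_modEq_iff (k : ℕ) (v : ℕ → ℤ) (h : ℕ) :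
    (∀ m ≤ k, eigenvalueShift k v m ≡ 2 ^ h * m [ZMOD 2 ^ (h + 1)]) ↔
      ∀ j ∈ Icc 1 k, v j * ((2 * j).choose j : ℤ) ≡
        (if binaryDigitSum j = 1 then 2 ^ h else 0) [ZMOD 2 ^ (h + 1)] := by
  set e : ℕ → ℤ := fun j => if binaryDigitSum j = 1 then 2 ^ h else 0 with he
  -- `e` is a solution of the triangular system, so by unitriangularity it is the only one modulo
  -- `2^(h+1)`.
  have hsum : ∀ m ≤ k, ∑ j ∈ Icc 1 k, ((m + j).choose (2 * j) : ℤ) * e j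
      ≡ 2 ^ h * m [ZMOD 2 ^ (h + 1)] := by
    intro m hm
    have h1 := (sum_choose_binaryDigitSum_eq_one m (k + 1) (by omega)).mul_left' (c := 2 ^ h)
    rw [← pow_succ] at h1
    refine Int.ModEq.trans (congrArg (· % (2 ^ (h + 1) : ℤ)) ?_) h1
    rw [sum_range_succ', mul_add, sum_Icc_one_eq_sum_range, mul_sum]
    simp [he, binaryDigitSum, mul_comm]
  constructor
  · intro hm
    have htri := dvd_of_unitriangular (N := 2 ^ (h + 1)) (n := k)
      (fun p i => ((p + 1 + (i + 1)).choose (2 * (i + 1)) : ℤ))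
      (fun i => v (i + 1) * ((2 * (i + 1)).choose (i + 1) : ℤ) - e (i + 1))
      (fun p => by rw [← two_mul, Nat.choose_self, Nat.cast_one]) fun p hp => by
        have h1 := ((hm (p + 1) hp).trans (hsum (p + 1) hp).symm).symm.dvd
        rw [eigenvalueShift_eq, ← sum_sub_distrib, sum_Icc_one_eq_sum_range] at h1
        convert h1 using 1
        simp_rw [← mul_sub]
        refine sum_subset (range_mono (by omega)) fun j _ hj => ?_
        rw [mem_range] at hj
        rw [Nat.choose_eq_zero_of_lt (by omega), Nat.cast_zero, zero_mul]
    intro j hj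
    rw [mem_Icc] at hj
    have := htri (j - 1) (by omega)
    rw [Nat.sub_add_cancel hj.1] at this
    exact ((Int.modEq_iff_dvd).2 this).symm
  · intro hj m hm
    refine Int.ModEq.trans ?_ (hsum m hm)
    rw [eigenvalueShift_eq]
    exact Int.ModEq.sum fun j hjk => (hj j hjk).mul_left _

theorem odd_mul_modEq_two_pow_iff {h : ℕ} {q x : ℤ} (hq : Odd q) :
    x * q ≡ 2 ^ h [ZMOD 2 ^ (h + 1)] ↔ x ≡ 2 ^ h [ZMOD 2 ^ (h + 1)] := by
  have hq2 : 2 ^ h * q ≡ 2 ^ h [ZMOD 2 ^ (h + 1)] := by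
    obtain ⟨c, rfl⟩ := hq
    exact (Int.modEq_iff_dvd.2 ⟨c, by ring⟩).symm
  constructor
  · intro hx
    have h1 := Int.modEq_iff_dvd.1 (hx.trans hq2.symm)
    rw [← sub_mul] at h1
    exact Int.modEq_iff_dvd.2 (IsCoprime.dvd_of_dvd_mul_right
      (Int.isCoprime_two_left.2 hq).pow_left h1)
  · intro hx
    exact (hx.mul_right q).trans hq2

/-- Write `C(2j,j) = 2^s q` with `q` odd and `s` the digit sum of `j`, and cancel. If `s > h`, the
modulus `2^(h+1)` already divides `2^s`, so nothing is asked of `x`. -/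
theorem coefficient_modEq_iff {j h : ℕ} (hj : 1 ≤ j) (hh : 1 ≤ h) (x : ℤ) :
    x * ((2 * j).choose j : ℤ) ≡ (if binaryDigitSum j = 1 then 2 ^ h else 0) [ZMOD 2 ^ (h + 1)] ↔
      (binaryDigitSum j = 1 → x ≡ 2 ^ (h - 1) [ZMOD 2 ^ h]) ∧
      (2 ≤ binaryDigitSum j → binaryDigitSum j ≤ h →
        x ≡ 0 [ZMOD 2 ^ (h + 1 - binaryDigitSum j)]) := by
  obtain ⟨q, hq, hc⟩ := exists_odd_choose_two_mul j
  have hq' : Odd (q : ℤ) := by exact_mod_cast hq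
  have h0 : binaryDigitSum j ≠ 0 := binaryDigitSum_eq_zero.not.2 (by omega)
  obtain ⟨g, rfl⟩ : ∃ g, h = g + 1 := ⟨h - 1, by omega⟩
  rw [hc]
  push_cast
  generalize binaryDigitSum j = s at *
  by_cases hs : s = 1
  · subst hs
    have : (2 : ℤ) ≠ 0 := two_ne_zero
    rw [if_pos rfl, show x * (2 ^ 1 * (q : ℤ)) = 2 * (x * q) by ring, pow_succ' 2 (g + 1),
      pow_succ' 2 g, Int.modEq_iff_dvd, ← mul_sub, mul_dvd_mul_iff_left this,
      ← Int.modEq_iff_dvd, ← pow_succ', odd_mul_modEq_two_pow_iff hq']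
    simp
  · rw [if_neg hs]
    simp only [hs, false_imp_iff, true_and, show 2 ≤ s by omega, true_imp_iff]
    rw [Int.modEq_zero_iff_dvd]
    by_cases hsh : s ≤ g + 1
    · simp only [hsh, true_imp_iff]
      rw [Int.modEq_zero_iff_dvd]
      conv_lhs => rw [show g + 1 + 1 = s + (g + 1 + 1 - s) by omega, pow_add,
        show x * (2 ^ s * (q : ℤ)) = 2 ^ s * (x * q) by ring,
        mul_dvd_mul_iff_left (pow_ne_zero s (two_ne_zero' ℤ))]
      exact ⟨fun hd => IsCoprime.dvd_of_dvd_mul_right (Int.isCoprime_two_left.2 hq').pow_left hd,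
        fun hd => hd.mul_right _⟩
    · simp only [hsh, false_imp_iff, iff_true]
      exact ((pow_dvd_pow 2 (by omega)).mul_right _).mul_left x

theorem sum_Icc_sub_eq_sum_range {M : Type*} [AddCommMonoid M] {k p : ℕ} (hp : p ≤ k) (g : ℕ → M) :
    ∑ j ∈ Icc (k - p) k, g j = ∑ i ∈ range (p + 1), g (k - i) := by
  refine sum_nbij' (fun j => k - j) (fun i => k - i) ?_ ?_ ?_ ?_ ?_
  · intro j hj
    rw [mem_Icc] at hj
    rw [mem_range]
    omega
  · intro i hi
    rw [mem_range] at hi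
    rw [mem_Icc]
    omega
  · intro j hj
    rw [mem_Icc] at hj
    exact Nat.sub_sub_self hj.2
  · intro i hi
    rw [mem_range] at hi
    exact Nat.sub_sub_self (by omega)
  · intro j hj
    rw [mem_Icc] at hj
    rw [Nat.sub_sub_self hj.2]

/-- Binomial inversion of the weights. -/
theorem exists_weight_inversion (k : ℕ) (w : ℕ → ℤ) :
    ∃ v : ℕ → ℤ, ∀ r ∈ Icc 1 k, w r = ∑ j ∈ Icc r k, v j * ((k - r).choose (j - r) : ℤ) := by
  -- Newton's forward difference formula at 0 for the reversed weights `p ↦ w (k - p)`.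
  refine ⟨fun j => (fwdDiff 1)^[k - j] (fun p => w (k - p)) 0, fun r hr => ?_⟩
  rw [mem_Icc] at hr
  have h := shift_eq_sum_fwdDiff_iter (1 : ℕ) (fun p => w (k - p)) (k - r) 0
  simp only [smul_eq_mul, mul_one, zero_add, nsmul_eq_mul, Nat.sub_sub_self hr.2] at h
  have hI := sum_Icc_sub_eq_sum_range (k := k) (p := k - r) (by omega)
    (fun j => (fwdDiff 1)^[k - j] (fun p => w (k - p)) 0 * ((k - r).choose (j - r) : ℤ))
  rw [Nat.sub_sub_self hr.2] at hI
  rw [h, hI]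
  refine sum_congr rfl fun i hi => ?_
  rw [mem_range] at hi
  rw [mul_comm, Nat.sub_sub_self (by omega), show k - i - r = k - r - i by omega,
    Nat.choose_symm (by omega)]

theorem weightCondition_iff {k : ℕ} (hk : 1 ≤ k) {w v : ℕ → ℤ}
    (hv : ∀ r ∈ Icc 1 k, w r = ∑ j ∈ Icc r k, v j * ((k - r).choose (j - r) : ℤ)) (h : ℕ) :
    (1 ≤ h ∧ WeightCondition k w h) ↔
      ∀ m ≤ k, eigenvalueShift k v m ≡ 2 ^ h * m [ZMOD 2 ^ (h + 1)] := by
  rw [eigenvalueShift_modEq_iff]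
  constructor
  · rintro ⟨hh, u, hu, huw⟩ j hj
    -- The witness `u` represents the weights only modulo `2^h`, but this determines it modulo
    -- `2^h`.
    have hcong : ∀ j ∈ Icc 1 k, v j ≡ u j [ZMOD 2 ^ h] := by
      have htri := dvd_of_unitriangular (N := 2 ^ h) (n := k)
        (fun p i => (p.choose (p - i) : ℤ)) (fun i => u (k - i) - v (k - i)) (by simp)
        fun p hp => by
          have h1 := huw (k - p) (mem_Icc.2 (by omega))
          rw [hv (k - p) (mem_Icc.2 (by omega)), sum_Icc_sub_eq_sum_range hp.le,
            sum_Icc_sub_eq_sum_range hp.le] at h1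
          have h2 := h1.dvd
          rw [← sum_sub_distrib] at h2
          convert h2 using 1
          refine sum_congr rfl fun i hi => ?_
          rw [mem_range] at hi
          rw [Nat.sub_sub_self hp.le, show k - i - (k - p) = p - i by omega]
          ring
      intro j hj
      rw [mem_Icc] at hj
      have := htri (k - j) (by omega)
      rw [Nat.sub_sub_self hj.2] at this
      exact Int.modEq_iff_dvd.2 this
    obtain ⟨h1, h2⟩ := hu j hj
    rw [coefficient_modEq_iff (mem_Icc.1 hj).1 hh]
    exact ⟨fun hs => (hcong j hj).trans (h1 hs), fun hs hs' =>
      ((hcong j hj).of_dvd (pow_dvd_pow 2 (by omega))).trans (h2 hs hs')⟩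
  · intro hj
    -- For `h = 0` the congruence at `j = 1` would read `2 * v 1 ≡ 1` mod 2.
    have hh : 1 ≤ h := by
      by_contra h0
      obtain rfl : h = 0 := by omega
      have h1 := (hj 1 (mem_Icc.2 ⟨le_rfl, hk⟩)).dvd
      simp only [binaryDigitSum, mul_one, Nat.choose_one_right] at h1
      norm_num at h1
      omega
    exact ⟨hh, v, fun j hjk => (coefficient_modEq_iff (mem_Icc.1 hjk).1 hh _).1 (hj j hjk),
      fun r hr => by rw [hv r hr]⟩

/-! ### Phase conditions and greatest common divisors. -/

/-- A real `τ` clearing all the integers `f m` to integers also clears their greatest common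
divisor. -/
theorem exists_phase_gcd {k : ℕ} (hk : 1 ≤ k) (f : ℕ → ℤ) (hf : f 1 ≠ 0) :
    ∃ g : ℕ, g ≠ 0 ∧ (∀ m ≤ k, (g : ℤ) ∣ f m) ∧
      ∀ τ : ℝ, (∀ m ≤ k, ∃ n : ℤ, τ * f m = n) → ∃ n : ℤ, τ * g = n := by
  have hdvd : ∀ m ≤ k, (range (k + 1)).gcd f ∣ f m := fun m hm =>
    gcd_dvd (mem_range.2 (by omega))
  refine ⟨((range (k + 1)).gcd f).natAbs, ?_, fun m hm => Int.natAbs_dvd.2 (hdvd m hm), ?_⟩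
  · rw [Int.natAbs_ne_zero]
    rintro h0
    have := hdvd 1 hk
    rw [h0, zero_dvd_iff] at this
    exact hf this
  · intro τ hτ
    choose! n hn using hτ
    obtain ⟨c, hc⟩ := Finset.gcd_eq_sum_mul (range (k + 1)) f
    have hsum : τ * (((range (k + 1)).gcd f : ℤ) : ℝ) = (∑ m ∈ range (k + 1), n m * c m : ℤ) := by
      rw [hc]
      push_cast
      rw [mul_sum]
      refine sum_congr rfl fun m hm => ?_
      rw [← mul_assoc, hn m (by rw [mem_range] at hm; omega)]
    rcases Int.natAbs_eq ((range (k + 1)).gcd f) with h | h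
    · exact ⟨_, by rw [← hsum, ← Int.cast_natCast (R := ℝ), ← h]⟩
    · refine ⟨-(∑ m ∈ range (k + 1), n m * c m : ℤ), ?_⟩
      have hneg : (((range (k + 1)).gcd f).natAbs : ℤ) = -(range (k + 1)).gcd f := by omega
      rw [Int.cast_neg, ← hsum, ← mul_neg, ← Int.cast_natCast (R := ℝ), hneg, Int.cast_neg]

/-- With `2^h z` the gcd of the `f m` and `f m = 2^h z q`, the integer `N = τ 2^h z` satisfies `N q
= m + 2n`. The case `m = 1` forces `N` odd, so `q ≡ m` mod 2. -/
theorem exists_modEq_of_phase {k : ℕ} (hk : 1 ≤ k) (f : ℕ → ℤ) (τ : ℝ)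
    (hτ : ∀ m ≤ k, ∃ n : ℤ, τ * f m = m + 2 * n) :
    ∃ h : ℕ, ∀ m ≤ k, f m ≡ 2 ^ h * m [ZMOD 2 ^ (h + 1)] := by
  have hf : f 1 ≠ 0 := by
    intro h0
    obtain ⟨n, hn⟩ := hτ 1 hk
    rw [h0] at hn
    have : (0 : ℤ) = 1 + 2 * n := by exact_mod_cast (by simpa using hn : (0 : ℝ) = 1 + 2 * n)
    omega
  obtain ⟨g, hg, hdvd, hbez⟩ := exists_phase_gcd hk f hf
  obtain ⟨N, hN⟩ := hbez τ fun m hm => by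
    obtain ⟨n, hn⟩ := hτ m hm
    exact ⟨m + 2 * n, by rw [hn]; push_cast; ring⟩
  obtain ⟨h, z, hz, rfl⟩ := Nat.exists_eq_two_pow_mul_odd hg
  have hquot : ∀ m ≤ k, ∃ q n : ℤ, f m = 2 ^ h * z * q ∧ N * q = m + 2 * n := by
    intro m hm
    obtain ⟨q, hq⟩ := hdvd m hm
    obtain ⟨n, hn⟩ := hτ m hm
    refine ⟨q, n, by rw [hq]; push_cast; ring, ?_⟩
    have : (N : ℝ) * q = m + 2 * n := by
      rw [← hN, ← hn, hq]
      push_cast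
      ring
    exact_mod_cast this
  obtain ⟨q₁, n₁, -, h₁⟩ := hquot 1 hk
  have hNodd : Odd N := by
    have : Odd (N * q₁) := h₁ ▸ ⟨n₁, by push_cast; ring⟩
    exact (Int.odd_mul.1 this).1
  refine ⟨h, fun m hm => ?_⟩
  obtain ⟨q, n, hq, hqn⟩ := hquot m hm
  obtain ⟨a, rfl⟩ := hNodd
  obtain ⟨b, rfl⟩ := hz
  refine (Int.modEq_iff_dvd.2 ⟨b * q - a * q + n, ?_⟩).symm
  rw [hq]
  push_cast
  linear_combination (2 ^ h) * hqn

theorem exists_odd_phase_iff {k : ℕ} (hk : 1 ≤ k) (f : ℕ → ℤ) (h : ℕ)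
    (hf : ∀ m ≤ k, f m ≡ 2 ^ h * m [ZMOD 2 ^ (h + 1)]) :
    ∃ z : ℕ, Odd z ∧ ∀ τ : ℝ, (∀ m ≤ k, ∃ n : ℤ, τ * f m = m + 2 * n) ↔
      ∃ n : ℤ, Odd n ∧ τ = n / (2 ^ h * z) := by
  have hval : ∀ m ≤ k, ∃ c : ℤ, f m = 2 ^ h * (m + 2 * c) := by
    intro m hm
    obtain ⟨c, hc⟩ := (hf m hm).symm.dvd
    exact ⟨c, by rw [pow_succ] at hc; linear_combination hc⟩
  have h2 : (2 : ℤ) ^ h ≠ 0 := pow_ne_zero _ two_ne_zero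
  obtain ⟨c₁, hc₁⟩ := hval 1 hk
  have hf1 : f 1 ≠ 0 := by
    rw [hc₁]
    exact mul_ne_zero h2 (by push_cast; omega)
  obtain ⟨g, hg, hdvd, hbez⟩ := exists_phase_gcd hk f hf1
  -- The phase `1 / 2^h` clears every `f m`, hence also their gcd.
  have hg2 : 2 ^ h ∣ g := by
    obtain ⟨N, hN⟩ := hbez (1 / 2 ^ h) fun m hm => by
      obtain ⟨c, hc⟩ := hval m hm
      refine ⟨m + 2 * c, ?_⟩
      rw [hc]
      push_cast
      field_simp
    have : (g : ℝ) = (2 ^ h * N : ℤ) := by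
      push_cast
      rw [← hN]
      field_simp
    have hgN : (g : ℤ) = 2 ^ h * N := by exact_mod_cast this
    exact_mod_cast (Dvd.intro _ hgN.symm : (2 : ℤ) ^ h ∣ g)
  obtain ⟨z, rfl⟩ := hg2
  have hquot : ∀ m ≤ k, ∃ q c : ℤ, f m = 2 ^ h * z * q ∧ z * q = m + 2 * c := by
    intro m hm
    obtain ⟨q, hq⟩ := hdvd m hm
    obtain ⟨c, hc⟩ := hval m hm
    push_cast at hq
    exact ⟨q, c, hq, mul_left_cancel₀ h2 (by rw [← hc, hq]; ring)⟩
  obtain ⟨q₁, c₁, hq₁, hqc₁⟩ := hquot 1 hk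
  have hodd₁ : Odd ((z : ℤ) * q₁) := hqc₁ ▸ ⟨c₁, by push_cast; ring⟩
  have hz : Odd z := by exact_mod_cast (Int.odd_mul.1 hodd₁).1
  have hz0 : (z : ℝ) ≠ 0 := by
    have := hz.pos
    positivity
  refine ⟨z, hz, fun τ => ⟨fun hτ => ?_, ?_⟩⟩
  · obtain ⟨N, hN⟩ := hbez τ fun m hm => by
      obtain ⟨n, hn⟩ := hτ m hm
      exact ⟨m + 2 * n, by rw [hn]; push_cast; ring⟩
    refine ⟨N, ?_, ?_⟩
    · obtain ⟨n, hn⟩ := hτ 1 hk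
      have : (N : ℝ) * q₁ = 1 + 2 * n := by
        rw [← hN, hq₁] at *
        push_cast at hn ⊢
        linear_combination hn
      have hNq : N * q₁ = 1 + 2 * n := by exact_mod_cast this
      have : Odd (N * q₁) := hNq ▸ ⟨n, by ring⟩
      exact (Int.odd_mul.1 this).1
    · rw [← hN]
      push_cast
      field_simp
  · rintro ⟨N, ⟨a, rfl⟩, rfl⟩ m hm
    obtain ⟨q, c, hq, hqc⟩ := hquot m hm
    obtain ⟨b, rfl⟩ := hz
    refine ⟨c + a * q - b * q, ?_⟩
    have : (((2 * b + 1 : ℕ) : ℝ)) * q = m + 2 * c := by exact_mod_cast hqc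
    rw [hq]
    push_cast at *
    field_simp
    linear_combination this

end Arithmetic

/-! ### Multiplication in the Johnson scheme. -/

section JohnsonScheme

open Finset

theorem sum_card_eq_of_subset {α M : Type*} [Fintype α] [DecidableEq α] [AddCommMonoid M] {r : ℕ}
    {R : Finset α} (hR : #R = r) (g : Finset α → M) :
    ∑ c : {s : Finset α // #s = r + 1}, (if R ⊆ c.1 then g c.1 else 0) =
      ∑ q ∈ Rᶜ, g (insert q R) := by
  rw [← sum_subtype (powersetCard (r + 1) univ) (by simp [mem_powersetCard])
    (fun c => if R ⊆ c then g c else 0), ← sum_filter]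
  symm
  refine sum_nbij (fun q => insert q R) ?_ ?_ ?_ fun _ _ => rfl
  · intro q hq
    rw [mem_compl] at hq
    simp [mem_powersetCard, card_insert_of_notMem hq, hR]
  · intro q hq q' hq' h
    rw [mem_coe, mem_compl] at hq hq'
    have h' : insert q R = insert q' R := h
    have : q ∈ insert q' R := h' ▸ mem_insert_self q R
    exact (mem_insert.1 this).resolve_right hq
  · intro c hc
    rw [mem_coe, mem_filter, mem_powersetCard] at hc
    have h1 : #(c \ R) = 1 := by
      rw [card_sdiff_of_subset hc.2, hc.1.2, hR, Nat.add_sub_cancel_left]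
    obtain ⟨q, hq⟩ := card_eq_one.1 h1
    have hqc : q ∈ c \ R := hq ▸ mem_singleton_self q
    refine ⟨q, by simpa using (mem_sdiff.1 hqc).2, ?_⟩
    rw [← sdiff_union_of_subset hc.2, hq]
    rfl

theorem sum_powersetCard_pred {α M : Type*} [DecidableEq α] [AddCommMonoid M] {r : ℕ}
    {a : Finset α} (ha : #a = r + 1) (h : Finset α → M) :
    ∑ R ∈ powersetCard r a, h R = ∑ p ∈ a, h (a.erase p) := by
  symm
  refine sum_nbij (fun p => a.erase p) ?_ ?_ ?_ fun _ _ => rfl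
  · intro p hp
    simp [mem_powersetCard, erase_subset, card_erase_of_mem hp, ha]
  · intro p hp p' hp' h
    by_contra hne
    have : p ∈ a.erase p' := mem_erase.2 ⟨hne, hp⟩
    have h' : a.erase p = a.erase p' := h
    rw [← h'] at this
    simp at this
  · intro R hR
    rw [mem_coe, mem_powersetCard] at hR
    have h1 : #(a \ R) = 1 := by
      rw [card_sdiff_of_subset hR.1, ha, hR.2, Nat.add_sub_cancel_left]
    obtain ⟨p, hp⟩ := card_eq_one.1 h1
    have hpa : p ∈ a \ R := hp ▸ mem_singleton_self p
    refine ⟨p, (mem_sdiff.1 hpa).1, ?_⟩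
    change a.erase p = R
    rw [← sdiff_singleton_eq_erase, ← hp, Finset.sdiff_sdiff_eq_self hR.1]

theorem choose_card_inter_eq_sum {α : Type*} [DecidableEq α] (r : ℕ) (a c : Finset α) :
    (#(a ∩ c)).choose r = ∑ R ∈ powersetCard r a, if R ⊆ c then 1 else 0 := by
  rw [← card_powersetCard, ← card_filter]
  congr 1
  ext R
  simp only [mem_powersetCard, mem_filter, subset_inter_iff]
  tauto

/-- The coefficient counts the common `r`-subsets of `a` and `c`. As `#a = r + 1`, each is `a` with
one point removed, so the sum runs over removing a point and then adding one. -/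
theorem sum_choose_card_inter_mul {α : Type*} [Fintype α] [DecidableEq α] {r : ℕ}
    {a : Finset α} (ha : #a = r + 1) (g : Finset α → ℂ) :
    ∑ c : {s : Finset α // #s = r + 1}, ((#(a ∩ c.1)).choose r : ℂ) * g c.1 =
      ∑ p ∈ a, ∑ q ∈ (a.erase p)ᶜ, g (insert q (a.erase p)) := by
  simp_rw [choose_card_inter_eq_sum, Nat.cast_sum, sum_mul]
  rw [sum_comm, sum_powersetCard_pred ha]
  refine sum_congr rfl fun p hp => ?_
  rw [← sum_card_eq_of_subset (by rw [card_erase_of_mem hp, ha, Nat.add_sub_cancel])]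
  refine sum_congr rfl fun c _ => ?_
  split_ifs <;> simp

theorem sum_insert_card_inter {α : Type*} [Fintype α] [DecidableEq α] {k : ℕ}
    (hα : Fintype.card α = 2 * k) {R b : Finset α} (hR : #R + 1 = k) (hb : #b = k) (φ : ℕ → ℂ) :
    ∑ q ∈ Rᶜ, φ #(insert q R ∩ b) =
      ((k : ℂ) - #(R ∩ b)) * φ (#(R ∩ b) + 1) + (#(R ∩ b) + 1) * φ #(R ∩ b) := by
  have hterm : ∀ q ∈ Rᶜ, φ #(insert q R ∩ b) =
      if q ∈ b then φ (#(R ∩ b) + 1) else φ #(R ∩ b) := by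
    intro q hq
    rw [mem_compl] at hq
    split_ifs with hqb
    · rw [insert_inter_of_mem hqb, card_insert_of_notMem (by simp [hq])]
    · rw [insert_inter_of_notMem hqb]
  rw [sum_congr rfl hterm, sum_ite, sum_const, sum_const, nsmul_eq_mul, nsmul_eq_mul]
  have h1 : #{q ∈ Rᶜ | q ∈ b} + #(R ∩ b) = k := by
    rw [← hb, ← card_sdiff_add_card_inter b R, inter_comm R b]
    congr 2
    ext q
    simp [and_comm]
  -- This is where the ground set having exactly `2k` points enters.
  have h2 : #{q ∈ Rᶜ | q ∈ b} + #{q ∈ Rᶜ | q ∉ b} = k + 1 := by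
    rw [card_filter_add_card_filter_not, card_compl, hα]
    omega
  have h3 : #{q ∈ Rᶜ | q ∉ b} = #(R ∩ b) + 1 := by omega
  rw [h3, ← h1]
  push_cast
  ring

/-- The action of the Johnson scheme on functions of the intersection size. -/
theorem sum_choose_mul_inter {α : Type*} [Fintype α] [DecidableEq α] {k r : ℕ} (hr : r + 1 = k)
    (hα : Fintype.card α = 2 * k) {a b : Finset α} (ha : #a = k) (hb : #b = k) (φ : ℕ → ℂ) :
    ∑ c : {s : Finset α // #s = k}, ((#(a ∩ c.1)).choose r : ℂ) * φ #(c.1 ∩ b) =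
      (#(a ∩ b) : ℂ) * (((k : ℂ) - #(a ∩ b) + 1) * φ #(a ∩ b) + #(a ∩ b) * φ (#(a ∩ b) - 1)) +
      ((k : ℂ) - #(a ∩ b)) *
        (((k : ℂ) - #(a ∩ b)) * φ (#(a ∩ b) + 1) + (#(a ∩ b) + 1) * φ #(a ∩ b)) := by
  subst hr
  rw [sum_choose_card_inter_mul ha (fun c => φ #(c ∩ b))]
  have hterm : ∀ p ∈ a, ∑ q ∈ (a.erase p)ᶜ, φ #(insert q (a.erase p) ∩ b) =
      if p ∈ b then (((r + 1 : ℕ) : ℂ) - #(a ∩ b) + 1) * φ #(a ∩ b) + #(a ∩ b) * φ (#(a ∩ b) - 1)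
      else (((r + 1 : ℕ) : ℂ) - #(a ∩ b)) * φ (#(a ∩ b) + 1) + (#(a ∩ b) + 1) * φ #(a ∩ b) := by
    intro p hp
    rw [sum_insert_card_inter hα (by rw [card_erase_add_one hp, ha]) hb]
    split_ifs with hpb
    · have hpab : p ∈ a ∩ b := mem_inter.2 ⟨hp, hpb⟩
      have hc := card_erase_add_one hpab
      rw [← erase_inter] at hc
      rw [← hc, Nat.add_sub_cancel]
      push_cast
      ring
    · rw [erase_inter, erase_eq_of_notMem (by simp [hpb])]
  rw [sum_congr rfl hterm, sum_ite, sum_const, sum_const, nsmul_eq_mul, nsmul_eq_mul,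
    filter_mem_eq_inter]
  have h2 : (#(a ∩ b) : ℂ) + #{p ∈ a | p ∉ b} = (r + 1 : ℕ) := by
    rw [← filter_mem_eq_inter, ← ha]
    exact_mod_cast card_filter_add_card_filter_not (s := a) (· ∈ b)
  rw [← h2]
  ring

/-- The `k`-subsets of a `2k`-set. -/
abbrev HalfSubset (k : ℕ) : Type := {s : Finset (Fin (2 * k)) // #s = k}

/-- The Gram matrix of the inclusion matrix of `(k - j)`-subsets against `k`-subsets: the `(a, b)` entry counts the
common `(k - j)`-subsets of `a` and `b`. -/
def inclusionGram (k j : ℕ) : Matrix (HalfSubset k) (HalfSubset k) ℂ :=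
  Matrix.of fun a b => ((#(a.1 ∩ b.1)).choose (k - j) : ℂ)

theorem inclusionGram_apply (k j : ℕ) (a b : HalfSubset k) :
    inclusionGram k j a b = ((#(a.1 ∩ b.1)).choose (k - j) : ℂ) := rfl

theorem card_inter_eq_iff {k : ℕ} {a b : HalfSubset k} : #(a.1 ∩ b.1) = k ↔ a = b := by
  constructor
  · intro h
    have h1 : a.1 ∩ b.1 = a.1 := eq_of_subset_of_card_le inter_subset_left (by rw [h, a.2])
    have h2 : a.1 ∩ b.1 = b.1 := eq_of_subset_of_card_le inter_subset_right (by rw [h, b.2])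
    exact Subtype.ext (h1.symm.trans h2)
  · rintro rfl
    rw [inter_self, a.2]

theorem card_inter_le {k : ℕ} (a b : HalfSubset k) : #(a.1 ∩ b.1) ≤ k :=
  (card_le_card inter_subset_left).trans a.2.le

theorem inclusionGram_zero (k : ℕ) : inclusionGram k 0 = 1 := by
  ext a b
  rw [inclusionGram_apply, Nat.sub_zero, Matrix.one_apply]
  split_ifs with h
  · rw [card_inter_eq_iff.2 h, Nat.choose_self, Nat.cast_one]
  · rw [Nat.choose_eq_zero_of_lt, Nat.cast_zero]
    exact lt_of_le_of_ne (card_inter_le a b) (card_inter_eq_iff.not.2 h)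

theorem inclusionGram_one_mul_apply {k : ℕ} (hk : 1 ≤ k) (j : ℕ) (a b : HalfSubset k) :
    (inclusionGram k 1 * inclusionGram k j) a b =
      (#(a.1 ∩ b.1) : ℂ) * (((k : ℂ) - #(a.1 ∩ b.1) + 1) * (#(a.1 ∩ b.1)).choose (k - j) +
        #(a.1 ∩ b.1) * (#(a.1 ∩ b.1) - 1).choose (k - j)) +
      ((k : ℂ) - #(a.1 ∩ b.1)) *
        (((k : ℂ) - #(a.1 ∩ b.1)) * (#(a.1 ∩ b.1) + 1).choose (k - j) +
          (#(a.1 ∩ b.1) + 1) * (#(a.1 ∩ b.1)).choose (k - j)) := by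
  rw [Matrix.mul_apply]
  exact sum_choose_mul_inter (Nat.sub_add_cancel hk) (by simp) a.2 b.2
    (fun x => (x.choose (k - j) : ℂ))

theorem cast_mul_choose_pred (x i : ℕ) :
    (x : ℂ) * ((x - 1).choose i : ℂ) = ((x : ℂ) - i) * (x.choose i : ℂ) := by
  rcases x with _ | x
  · rcases i with _ | i <;> simp
  · have h := Nat.choose_mul_succ_eq x i
    rw [Nat.add_sub_cancel]
    rcases le_or_gt i (x + 1) with hi | hi
    · have h' : (x.choose i : ℂ) * ((x : ℂ) + 1) = (x + 1).choose i * ((x : ℂ) + 1 - i) := by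
        have := congrArg (Nat.cast : ℕ → ℂ) h
        rw [Nat.cast_mul, Nat.cast_mul, Nat.cast_sub hi] at this
        exact_mod_cast this
      push_cast
      linear_combination h'
    · rw [Nat.choose_eq_zero_of_lt hi, Nat.choose_eq_zero_of_lt (by omega)]
      simp

theorem cast_choose_mul_sub (x i : ℕ) :
    ((x.choose (i + 1) : ℂ)) * ((i : ℂ) + 1) = (x.choose i : ℂ) * ((x : ℂ) - i) := by
  rcases le_or_gt i x with hi | hi
  · have := congrArg (Nat.cast : ℕ → ℂ) (Nat.choose_succ_right_eq x i)
    rw [Nat.cast_mul, Nat.cast_mul, Nat.cast_sub hi] at this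
    exact_mod_cast this
  · rw [Nat.choose_eq_zero_of_lt hi, Nat.choose_eq_zero_of_lt (by omega)]
    simp

/-- This two-term recurrence makes every Gram matrix a polynomial in `inclusionGram k 1` and exposes
the eigenvalues `j(j+1)`. It stops at `j = k`, where the Gram matrix is all ones. -/
theorem inclusionGram_one_mul {k j : ℕ} (hj : j + 1 ≤ k) :
    inclusionGram k 1 * inclusionGram k j =
      ((j : ℂ) * (j + 1)) • inclusionGram k j + ((j : ℂ) + 1) ^ 2 • inclusionGram k (j + 1) := by
  ext a b
  rw [inclusionGram_one_mul_apply (by omega), Matrix.add_apply, Matrix.smul_apply,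
    Matrix.smul_apply, inclusionGram_apply, inclusionGram_apply]
  generalize #(a.1 ∩ b.1) = x
  obtain ⟨i, rfl⟩ : ∃ i, k = j + 1 + i := ⟨k - (j + 1), by omega⟩
  rw [show j + 1 + i - j = i + 1 by omega, show j + 1 + i - (j + 1) = i by omega,
    cast_mul_choose_pred, Nat.choose_succ_succ' x i]
  have h := cast_choose_mul_sub x i
  simp only [smul_eq_mul]
  push_cast
  linear_combination (2 * ((j : ℂ) + 1 + i) - x - (i + 1) + 1) * h

theorem inclusionGram_one_mul_self {k : ℕ} (hk : 1 ≤ k) :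
    inclusionGram k 1 * inclusionGram k k = ((k : ℂ) * (k + 1)) • inclusionGram k k := by
  ext a b
  rw [inclusionGram_one_mul_apply hk, Matrix.smul_apply, inclusionGram_apply]
  simp only [Nat.sub_self, Nat.choose_zero_right, smul_eq_mul]
  push_cast
  ring

end JohnsonScheme

/-! ### Distances in the Johnson graph and the adjacency matrix of `X`. -/

section Graph

open Finset

theorem card_sdiff_le_length {n k : ℕ} {a b : {s : Finset (Fin n) // #s = k}}
    (p : (johnsonGraph n k).Walk a b) : #(a.1 \ b.1) ≤ p.length := by
  induction p with
  | nil => simp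
  | @cons a c b h p ih =>
    have h1 : #(a.1 \ c.1) = 1 := h
    have h2 : #(a.1 \ b.1) ≤ #(a.1 \ c.1) + #(c.1 \ b.1) := by
      refine (card_le_card fun x hx => ?_).trans (card_union_le _ _)
      simp only [mem_sdiff, mem_union] at hx ⊢
      tauto
    rw [SimpleGraph.Walk.length_cons]
    omega

theorem johnsonGraph_edist_le {n k : ℕ} (d : ℕ) : ∀ a b : {s : Finset (Fin n) // #s = k},
    #(a.1 \ b.1) = d → (johnsonGraph n k).edist a b ≤ d := by
  induction d with
  | zero =>
    intro a b h
    have hab : a.1 ⊆ b.1 := by rwa [card_eq_zero, sdiff_eq_empty_iff_subset] at h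
    have : a = b := Subtype.ext (eq_of_subset_of_card_le hab (by rw [a.2, b.2]))
    rw [this, SimpleGraph.edist_self]
    simp
  | succ d ih =>
    intro a b h
    have h' : #(b.1 \ a.1) = d + 1 := by rw [← h, card_sdiff_comm (b.2.trans a.2.symm)]
    obtain ⟨p, hp⟩ := card_pos.1 (by omega : 0 < #(a.1 \ b.1))
    obtain ⟨q, hq⟩ := card_pos.1 (by omega : 0 < #(b.1 \ a.1))
    rw [mem_sdiff] at hp hq
    have hpq : p ≠ q := by
      rintro rfl
      exact hq.2 hp.1
    have hq' : q ∉ a.1.erase p := fun hmem => hq.2 (mem_of_mem_erase hmem)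
    -- Exchanging `p` for `q` is one step towards `b`.
    let c : {s : Finset (Fin n) // #s = k} :=
      ⟨insert q (a.1.erase p), by rw [card_insert_of_notMem hq', card_erase_add_one hp.1, a.2]⟩
    have hac : a.1 \ c.1 = {p} := by
      ext x
      simp only [c, mem_sdiff, mem_insert, mem_erase, mem_singleton]
      constructor
      · tauto
      · rintro rfl
        tauto
    have hcb : c.1 \ b.1 = (a.1 \ b.1).erase p := by
      ext x
      simp only [c, mem_sdiff, mem_insert, mem_erase]
      constructor
      · rintro ⟨rfl | hx, hxb⟩
        · exact absurd hq.1 hxb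
        · tauto
      · tauto
    have h1 : (johnsonGraph n k).edist a c ≤ 1 := by
      refine (SimpleGraph.edist_eq_one_iff_adj.2 ?_).le
      change #(a.1 \ c.1) = 1
      rw [hac, card_singleton]
    have h2 := ih c b (by rw [hcb, card_erase_of_mem (mem_sdiff.2 hp), h, Nat.add_sub_cancel])
    calc (johnsonGraph n k).edist a b ≤ _ := SimpleGraph.edist_triangle (v := c)
      _ ≤ 1 + d := add_le_add h1 h2
      _ = ((d + 1 : ℕ) : ℕ∞) := by rw [add_comm]; push_cast; rfl

/-- The distance in the Johnson graph. -/
theorem johnsonGraph_edist {n k : ℕ} (a b : {s : Finset (Fin n) // #s = k}) :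
    (johnsonGraph n k).edist a b = #(a.1 \ b.1) :=
  le_antisymm (johnsonGraph_edist_le _ a b rfl)
    (le_iInf fun p => by exact_mod_cast card_sdiff_le_length p)

theorem card_sdiff_halfSubset {k : ℕ} (a b : HalfSubset k) :
    #(a.1 \ b.1) = k - #(a.1 ∩ b.1) := by
  have := card_sdiff_add_card_inter a.1 b.1
  rw [a.2] at this
  omega

theorem generalizedJohnsonGraph_adj {k r : ℕ} (hr : 1 ≤ r) (a b : HalfSubset k) :
    (generalizedJohnsonGraph (2 * k) k r).Adj a b ↔ k - #(a.1 ∩ b.1) = r := by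
  change a ≠ b ∧ (johnsonGraph (2 * k) k).edist a b = r ↔ _
  rw [johnsonGraph_edist, card_sdiff_halfSubset, Nat.cast_inj, and_iff_right_iff_imp]
  rintro h rfl
  rw [inter_self, a.2, Nat.sub_self] at h
  omega

/-- The weighted sum of adjacency matrices in terms of the matrices `inclusionGram`. -/
theorem weighted_sum_eq_inclusionGram {k : ℕ} {w v : ℕ → ℤ}
    (hv : ∀ r ∈ Icc 1 k, w r = ∑ j ∈ Icc r k, v j * ((k - r).choose (j - r) : ℤ)) :
    ∑ r ∈ Icc 1 k, (w r : ℂ) • (generalizedJohnsonGraph (2 * k) k r).adjMatrix ℂ =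
      ∑ j ∈ Icc 1 k, (v j : ℂ) • inclusionGram k j -
        (∑ j ∈ Icc 1 k, (v j : ℂ) * (k.choose j : ℂ)) • 1 := by
  ext a b
  simp only [Matrix.sum_apply, Matrix.sub_apply, Matrix.smul_apply, smul_eq_mul]
  rw [Matrix.one_apply]
  by_cases hab : a = b
  · subst hab
    rw [if_pos rfl, mul_one, sum_eq_zero, eq_comm, sub_eq_zero]
    · refine sum_congr rfl fun j hj => ?_
      rw [inclusionGram_apply, inter_self, a.2, Nat.choose_symm (mem_Icc.1 hj).2]
    · intro r _
      simp
  · have hlt : #(a.1 ∩ b.1) < k :=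
      lt_of_le_of_ne (card_inter_le a b) (card_inter_eq_iff.not.2 hab)
    rw [if_neg hab, mul_zero, sub_zero]
    set r := k - #(a.1 ∩ b.1) with hr
    have hrk : r ∈ Icc 1 k := mem_Icc.2 (by omega)
    rw [sum_eq_single_of_mem r hrk, SimpleGraph.adjMatrix_apply,
      if_pos ((generalizedJohnsonGraph_adj (by omega) a b).2 rfl), mul_one, hv r hrk]
    · push_cast
      refine (sum_congr rfl fun j hj => ?_).trans
        (sum_subset (Icc_subset_Icc_left (mem_Icc.1 hrk).1) fun j hj hj' => ?_)
      · rw [mem_Icc] at hj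
        rw [inclusionGram_apply, show #(a.1 ∩ b.1) = k - r by omega,
          ← Nat.choose_symm (by omega), show k - r - (j - r) = k - j by omega]
      · rw [mem_Icc] at hj hj'
        rw [inclusionGram_apply, Nat.choose_eq_zero_of_lt (by omega), Nat.cast_zero, mul_zero]
    · intro r' hr' hne
      rw [SimpleGraph.adjMatrix_apply, if_neg, mul_zero]
      rw [generalizedJohnsonGraph_adj (mem_Icc.1 hr').1]
      exact fun h => hne h.symm

end Graph

/-! ### Functional calculus of the scheme. -/

section Spectral

open Finset Polynomial

/-- The eigenvalues `m(m + 1)` of `inclusionGram k 1`. -/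
noncomputable def spectralNode (k : ℕ) (m : Fin (k + 1)) : ℂ := (m : ℂ) * ((m : ℂ) + 1)

theorem spectralNode_injective (k : ℕ) : Function.Injective (spectralNode k) := by
  intro m n h
  unfold spectralNode at h
  have h' : (m : ℕ) * ((m : ℕ) + 1) = (n : ℕ) * ((n : ℕ) + 1) := by exact_mod_cast h
  refine Fin.ext (le_antisymm ?_ ?_) <;> by_contra! hlt <;> nlinarith

/-- A polynomial proportional to the one that maps `inclusionGram k 1` to `inclusionGram k j`. -/
noncomputable def inclusionPoly (j : ℕ) : ℂ[X] :=
  ∏ i ∈ range j, (X - C ((i : ℂ) * ((i : ℂ) + 1)))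

theorem inclusionPoly_succ (j : ℕ) :
    inclusionPoly (j + 1) = (X - C ((j : ℂ) * ((j : ℂ) + 1))) * inclusionPoly j := by
  rw [inclusionPoly, prod_range_succ, mul_comm, inclusionPoly]

theorem aeval_inclusionPoly {k : ℕ} (j : ℕ) (hj : j ≤ k) :
    aeval (inclusionGram k 1) (inclusionPoly j) = ((j.factorial : ℂ) ^ 2) • inclusionGram k j := by
  induction j with
  | zero => simp [inclusionPoly, inclusionGram_zero]
  | succ j ih =>
    rw [inclusionPoly_succ, map_mul, ih (by omega),
      map_sub, aeval_X, aeval_C, sub_mul, mul_smul_comm, inclusionGram_one_mul hj,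
      Algebra.algebraMap_eq_smul_one, smul_mul_assoc, one_mul, Nat.factorial_succ]
    push_cast
    module

theorem aeval_inclusionPoly_succ {k : ℕ} (hk : 1 ≤ k) :
    aeval (inclusionGram k 1) (inclusionPoly (k + 1)) = 0 := by
  rw [inclusionPoly_succ, map_mul,
    aeval_inclusionPoly k le_rfl, map_sub, aeval_X, aeval_C, sub_mul, mul_smul_comm,
    inclusionGram_one_mul_self hk, Algebra.algebraMap_eq_smul_one, smul_mul_assoc, one_mul]
  module

/-- The eigenvalues of `inclusionGram k j`. -/
noncomputable def inclusionEigenvalue (j m : ℕ) : ℂ := (m.choose j : ℂ) * ((m + j).choose j : ℂ)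

theorem eval_inclusionPoly (j m : ℕ) :
    (inclusionPoly j).eval ((m : ℂ) * ((m : ℂ) + 1)) =
      ((j.factorial : ℂ) ^ 2) * inclusionEigenvalue j m := by
  induction j with
  | zero => simp [inclusionPoly, inclusionEigenvalue]
  | succ j ih =>
    rw [inclusionPoly, prod_range_succ, eval_mul, ← inclusionPoly, ih, Nat.factorial_succ]
    unfold inclusionEigenvalue
    have h1 := cast_choose_mul_sub m j
    have h2 : (((m + (j + 1)).choose (j + 1) : ℕ) : ℂ) * ((j : ℂ) + 1) =
        ((m : ℂ) + j + 1) * ((m + j).choose j : ℂ) := by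
      exact_mod_cast (Nat.add_one_mul_choose_eq (m + j) j).symm
    simp only [eval_sub, eval_X, eval_C]
    push_cast at *
    linear_combination (-(j.factorial : ℂ) ^ 2) * (h1 * ((m + (j + 1)).choose (j + 1) : ℂ) *
      ((j : ℂ) + 1) + h2 * ((m.choose j : ℂ) * ((m : ℂ) - j)))

/-- `inclusionPoly (k + 1)` annihilates `inclusionGram k 1` and has the distinct nodes as its simple
roots, so it divides `P - Q`. -/
theorem aeval_eq_aeval_of_eval_eq {k : ℕ} (hk : 1 ≤ k) {P Q : ℂ[X]}
    (h : ∀ m, P.eval (spectralNode k m) = Q.eval (spectralNode k m)) :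
    aeval (inclusionGram k 1) P = aeval (inclusionGram k 1) Q := by
  have hdvd : inclusionPoly (k + 1) ∣ P - Q := by
    have hprod : inclusionPoly (k + 1) = ∏ m : Fin (k + 1), (X - C (spectralNode k m)) :=
      (Fin.prod_univ_eq_prod_range (fun i : ℕ => X - C ((i : ℂ) * ((i : ℂ) + 1))) (k + 1)).symm
    rw [hprod]
    refine Finset.prod_dvd_of_coprime ?_ fun m _ => ?_
    · exact fun i _ j _ hij => pairwise_coprime_X_sub_C (spectralNode_injective k) hij
    · rw [dvd_iff_isRoot, IsRoot, eval_sub, h, sub_self]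
  obtain ⟨R, hR⟩ := hdvd
  rw [← sub_eq_zero, ← map_sub, hR, map_mul, aeval_inclusionPoly_succ hk, zero_mul]

/-- The functional calculus of `inclusionGram k 1`. -/
noncomputable def spectralHom {k : ℕ} (hk : 1 ≤ k) :
    (Fin (k + 1) → ℂ) →ₐ[ℂ] Matrix (HalfSubset k) (HalfSubset k) ℂ :=
  AlgHom.ofLinearMap
    ((aeval (inclusionGram k 1)).toLinearMap ∘ₗ Lagrange.interpolate univ (spectralNode k))
    (by
      simp [Lagrange.interpolate_one (spectralNode_injective k).injOn univ_nonempty])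
    (fun f g => by
      simp only [LinearMap.comp_apply, AlgHom.toLinearMap_apply]
      rw [← map_mul (aeval (inclusionGram k 1))]
      refine aeval_eq_aeval_of_eval_eq hk fun m => ?_
      simp only [eval_mul, Pi.mul_apply,
        Lagrange.eval_interpolate_at_node _ (spectralNode_injective k).injOn (mem_univ m)])

theorem spectralHom_eval {k : ℕ} (hk : 1 ≤ k) (P : ℂ[X]) :
    spectralHom hk (fun m => P.eval (spectralNode k m)) = aeval (inclusionGram k 1) P := by
  refine aeval_eq_aeval_of_eval_eq hk fun m => ?_
  rw [Lagrange.eval_interpolate_at_node _ (spectralNode_injective k).injOn (mem_univ m)]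

theorem spectralHom_inclusionEigenvalue {k : ℕ} (hk : 1 ≤ k) {j : ℕ} (hj : j ≤ k) :
    spectralHom hk (fun m => inclusionEigenvalue j m) = inclusionGram k j := by
  have hf : ((j.factorial : ℂ) ^ 2) ≠ 0 := pow_ne_zero _ (Nat.cast_ne_zero.2 j.factorial_ne_zero)
  refine (smul_right_injective _ hf) ?_
  change ((j.factorial : ℂ) ^ 2) • _ = ((j.factorial : ℂ) ^ 2) • _
  rw [← aeval_inclusionPoly j hj, ← spectralHom_eval hk, ← map_smul]
  congr 1
  ext m
  exact (eval_inclusionPoly j m).symm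

theorem exists_card_inter_eq {k x : ℕ} (hx : x ≤ k) :
    ∃ a b : HalfSubset k, #(a.1 ∩ b.1) = x := by
  -- The intervals `[0, k)` and `[k - x, 2k - x)` meet in `[k - x, k)`.
  refine ⟨⟨(range k).attachFin fun y hy => ?_, ?_⟩,
    ⟨(Ico (k - x) (2 * k - x)).attachFin fun y hy => ?_, ?_⟩, ?_⟩
  · rw [mem_range] at hy
    omega
  · simp
  · rw [mem_Ico] at hy
    omega
  · rw [card_attachFin, Nat.card_Ico]
    omega
  · have : (range k).attachFin (fun y hy => by rw [mem_range] at hy; omega) ∩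
        (Ico (k - x) (2 * k - x)).attachFin (fun y hy => by rw [mem_Ico] at hy; omega) =
        (Ico (k - x) k).attachFin (n := 2 * k) (fun y hy => by rw [mem_Ico] at hy; omega) := by
      ext y
      simp only [mem_inter, mem_attachFin, mem_range, mem_Ico]
      omega
    rw [this, card_attachFin, Nat.card_Ico]
    omega

/-- As functions of the intersection size `x`, the entries `C(x, k - j)` form a triangular system
with ones at `x = k - j`. -/
theorem inclusionGram_linearIndependent (k : ℕ) {c : Fin (k + 1) → ℂ}
    (h : ∑ j, c j • inclusionGram k j = 0) : c = 0 := by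
  have hval : ∀ x ≤ k, ∑ j : Fin (k + 1), c j * (x.choose (k - j) : ℂ) = 0 := by
    intro x hx
    obtain ⟨a, b, hab⟩ := exists_card_inter_eq hx
    have := congrFun (congrFun h a) b
    simpa [Matrix.sum_apply, inclusionGram_apply, hab] using this
  have hind : ∀ x : ℕ, ∀ j : Fin (k + 1), k - (j : ℕ) = x → c j = 0 := by
    intro x
    induction x using Nat.strong_induction_on with
    | _ x ih =>
      intro j hj
      have h1 := hval x (by omega)
      rw [sum_eq_single j] at h1
      · rwa [hj, Nat.choose_self, Nat.cast_one, mul_one] at h1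
      · intro i _ hij
        rcases lt_trichotomy (k - (i : ℕ)) x with hlt | heq | hgt
        · rw [ih _ hlt i rfl, zero_mul]
        · exact absurd (Fin.ext (by omega)) hij
        · rw [Nat.choose_eq_zero_of_lt hgt, Nat.cast_zero, mul_zero]
      · exact fun hne => absurd (mem_univ j) hne
  exact funext fun j => hind _ j rfl

/-- The eigenvalues of the linear combinations of the matrices `inclusionGram k j`. -/
noncomputable def combinationEigenvalues (k : ℕ) : (Fin (k + 1) → ℂ) →ₗ[ℂ] (Fin (k + 1) → ℂ) where
  toFun c m := ∑ j, c j * inclusionEigenvalue j m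
  map_add' c d := by
    ext m
    simp [add_mul, sum_add_distrib]
  map_smul' r c := by
    ext m
    simp [mul_sum, mul_assoc]

theorem spectralHom_combinationEigenvalues {k : ℕ} (hk : 1 ≤ k) (c : Fin (k + 1) → ℂ) :
    spectralHom hk (combinationEigenvalues k c) = ∑ j, c j • inclusionGram k j := by
  have h : combinationEigenvalues k c =
      ∑ j : Fin (k + 1), c j • fun m : Fin (k + 1) => inclusionEigenvalue j m := by
    ext m
    simp [combinationEigenvalues]
  rw [h, map_sum]
  refine sum_congr rfl fun j _ => ?_
  rw [map_smul, spectralHom_inclusionEigenvalue hk (by omega)]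

/-- Independence of the `k + 1` Gram matrices makes this endomorphism of a `(k + 1)`-dimensional
space injective. It yields injectivity of `spectralHom` without computing any eigenspace. -/
theorem combinationEigenvalues_surjective {k : ℕ} (hk : 1 ≤ k) :
    Function.Surjective (combinationEigenvalues k) := by
  refine LinearMap.injective_iff_surjective.1 ((injective_iff_map_eq_zero _).2 fun c hc => ?_)
  refine inclusionGram_linearIndependent k ?_
  rw [← spectralHom_combinationEigenvalues hk, hc, map_zero]

theorem spectralHom_injective {k : ℕ} (hk : 1 ≤ k) : Function.Injective (spectralHom hk) := by
  refine (injective_iff_map_eq_zero _).2 fun f hf => ?_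
  obtain ⟨c, rfl⟩ := combinationEigenvalues_surjective hk f
  rw [spectralHom_combinationEigenvalues] at hf
  rw [inclusionGram_linearIndependent k hf, map_zero]

/-- Matrices in the Johnson scheme have entries depending only on the intersection size. -/
theorem exists_spectralHom_apply {k : ℕ} (hk : 1 ≤ k) (f : Fin (k + 1) → ℂ) :
    ∃ φ : ℕ → ℂ, ∀ a b : HalfSubset k, spectralHom hk f a b = φ #(a.1 ∩ b.1) := by
  obtain ⟨c, rfl⟩ := combinationEigenvalues_surjective hk f
  refine ⟨fun x => ∑ j : Fin (k + 1), c j * (x.choose (k - j) : ℂ), fun a b => ?_⟩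
  simp [spectralHom_combinationEigenvalues, Matrix.sum_apply, inclusionGram_apply]

/-- The antipodal permutation matrix. -/
def antipodalMatrix (k : ℕ) : Matrix (HalfSubset k) (HalfSubset k) ℂ :=
  Matrix.of fun a b => if #(a.1 ∩ b.1) = 0 then 1 else 0

theorem sum_neg_one_pow_mul_inclusionEigenvalue {k m : ℕ} (hm : m ≤ k) :
    ∑ j ∈ range (k + 1), (-1 : ℂ) ^ j * inclusionEigenvalue j m = (-1) ^ m := by
  -- The terms of the sum are the coefficients of the shifted Legendre polynomial, whose reflection
  -- `x ↦ 1 - x` relates its value at 1 to its constant term 1.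
  have h := shiftedLegendre_eval_symm m (1 : ℂ)
  have h0 : (shiftedLegendre m).coeff 0 = 1 := by simp [coeff_shiftedLegendre]
  have h1 : aeval (1 : ℂ) (shiftedLegendre m) =
      ∑ j ∈ range (m + 1), (-1 : ℂ) ^ j * inclusionEigenvalue j m := by
    rw [aeval_eq_sum_range, natDegree_shiftedLegendre]
    refine sum_congr rfl fun j _ => ?_
    rw [coeff_shiftedLegendre, Nat.choose_symm_add]
    simp [inclusionEigenvalue, mul_assoc]
  have h2 : aeval (0 : ℂ) (shiftedLegendre m) = 1 := by
    rw [aeval_def, eval₂_at_zero, h0, map_one]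
  rw [h1, sub_self, h2] at h
  rw [← sum_subset (range_mono (by omega : m + 1 ≤ k + 1))]
  · simpa using h
  · intro j _ hj
    rw [mem_range] at hj
    rw [inclusionEigenvalue, Nat.choose_eq_zero_of_lt (by omega)]
    simp

/-- The combination of Gram matrices with coefficients `(-1)^(k+j)` has entries `∑ (-1)^i C(x,i)`,
with `x` the intersection size; this is 1 for `x = 0` and 0 otherwise. -/
theorem spectralHom_antipodal {k : ℕ} (hk : 1 ≤ k) :
    spectralHom hk (fun m => (-1) ^ (k + (m : ℕ))) = antipodalMatrix k := by
  have hc : (fun m : Fin (k + 1) => (-1 : ℂ) ^ (k + (m : ℕ))) =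
      combinationEigenvalues k fun j => (-1) ^ (k + (j : ℕ)) := by
    ext m
    have h := sum_neg_one_pow_mul_inclusionEigenvalue (k := k) (m := m) (by omega)
    rw [pow_add, ← h, mul_sum, ← Fin.sum_univ_eq_sum_range
      (fun j => (-1 : ℂ) ^ k * ((-1 : ℂ) ^ j * inclusionEigenvalue j m))]
    simp [combinationEigenvalues, pow_add, mul_assoc]
  rw [hc, spectralHom_combinationEigenvalues]
  ext a b
  simp only [Matrix.sum_apply, Matrix.smul_apply, smul_eq_mul, inclusionGram_apply]
  rw [Fin.sum_univ_eq_sum_range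
    (fun j => (-1 : ℂ) ^ (k + j) * ((#(a.1 ∩ b.1)).choose (k - j) : ℂ)) (k + 1),
    ← sum_range_reflect]
  have hle := card_inter_le a b
  have halt : ∑ i ∈ range (#(a.1 ∩ b.1) + 1), (-1 : ℂ) ^ i * ((#(a.1 ∩ b.1)).choose i : ℂ) =
      if #(a.1 ∩ b.1) = 0 then 1 else 0 := by
    exact_mod_cast Int.alternating_sum_range_choose (n := #(a.1 ∩ b.1))
  rw [antipodalMatrix, Matrix.of_apply, ← halt]
  rw [← sum_subset (range_mono (by omega : #(a.1 ∩ b.1) + 1 ≤ k + 1))]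
  · refine sum_congr rfl fun i hi => ?_
    rw [mem_range] at hi
    rw [show k + 1 - 1 - i = k - i by omega, Nat.sub_sub_self (by omega),
      show k + (k - i) = 2 * (k - i) + i by omega, pow_add, pow_mul]
    simp
  · intro i hi hi'
    rw [mem_range] at hi hi'
    rw [Nat.choose_eq_zero_of_lt (by omega), Nat.cast_zero, mul_zero]

end Spectral

/-! ### Perfect state transfer as a phase condition. -/

section Transfer

open Finset

open scoped Matrix.Norms.Operator in
theorem exp_mul_conjTranspose_exp {V : Type*} [Fintype V] [DecidableEq V] {B : Matrix V V ℂ}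
    (hB : B.conjTranspose = -B) :
    NormedSpace.exp B * (NormedSpace.exp B).conjTranspose = 1 := by
  rw [← Matrix.exp_conjTranspose, hB, ← Matrix.exp_add_of_commute _ _ (Commute.refl B).neg_right,
    add_neg_cancel, NormedSpace.exp_zero]

theorem sum_norm_sq_transitionMatrix {V : Type*} [Fintype V] [DecidableEq V] (X : SimpleGraph V)
    [DecidableRel X.Adj] (t : ℝ) (a : V) : ∑ b, ‖transitionMatrix X t a b‖ ^ 2 = 1 := by
  have hB : ((-(Complex.I * (t : ℂ))) • X.adjMatrix ℂ).conjTranspose =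
      -((-(Complex.I * (t : ℂ))) • X.adjMatrix ℂ) := by
    have hA : (X.adjMatrix ℂ).conjTranspose = X.adjMatrix ℂ := by
      ext u v
      simp [Matrix.conjTranspose_apply, SimpleGraph.adjMatrix_apply, SimpleGraph.adj_comm]
    rw [Matrix.conjTranspose_smul, hA, ← neg_smul]
    congr 1
    simp
  have hU : transitionMatrix X t * (transitionMatrix X t).conjTranspose = 1 :=
    exp_mul_conjTranspose_exp hB
  have h := congrFun (congrFun hU a) a
  rw [Matrix.mul_apply, Matrix.one_apply_eq] at h
  have h' : ((∑ b, ‖transitionMatrix X t a b‖ ^ 2 : ℝ) : ℂ) = 1 := by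
    rw [← h]
    push_cast
    refine sum_congr rfl fun b _ => ?_
    rw [Matrix.conjTranspose_apply, ← Complex.mul_conj']
    rfl
  exact_mod_cast h'

/-- An entry of modulus one exhausts the unit norm of its row. -/
theorem transitionMatrix_eq_zero_of_norm_eq_one {V : Type*} [Fintype V] [DecidableEq V]
    (X : SimpleGraph V) [DecidableRel X.Adj] {t : ℝ} {a b c : V}
    (hab : ‖transitionMatrix X t a b‖ = 1) (hbc : c ≠ b) : transitionMatrix X t a c = 0 := by
  have h := sum_norm_sq_transitionMatrix X t a
  have hle := sum_le_univ_sum_of_nonneg (s := {b, c})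
    (f := fun b => ‖transitionMatrix X t a b‖ ^ 2) fun _ => sq_nonneg _
  rw [h, sum_pair hbc.symm, hab] at hle
  have : ‖transitionMatrix X t a c‖ ^ 2 = 0 := le_antisymm (by linarith) (sq_nonneg _)
  exact norm_eq_zero.1 (pow_eq_zero_iff two_ne_zero |>.1 this)

open scoped Matrix.Norms.Operator in
theorem spectralHom_exp {k : ℕ} (hk : 1 ≤ k) (f : Fin (k + 1) → ℂ) :
    NormedSpace.exp (spectralHom hk f) = spectralHom hk fun m => Complex.exp (f m) := by
  have hcont : Continuous (spectralHom hk) :=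
    (spectralHom hk).toLinearMap.continuous_of_finiteDimensional
  refine (NormedSpace.map_exp (spectralHom hk) hcont f).symm.trans ?_
  rw [Pi.exp_def]
  simp only [Complex.exp_eq_exp_ℂ]

/-- The complement of a half-size subset. -/
def HalfSubset.compl {k : ℕ} (a : HalfSubset k) : HalfSubset k :=
  ⟨a.1ᶜ, by rw [card_compl, a.2, Fintype.card_fin]; omega⟩

theorem HalfSubset.card_inter_compl {k : ℕ} (a : HalfSubset k) : #(a.1 ∩ a.compl.1) = 0 := by
  change #(a.1 ∩ a.1ᶜ) = 0
  rw [inter_compl, card_empty]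

theorem HalfSubset.ne_compl {k : ℕ} (hk : 1 ≤ k) (a : HalfSubset k) : a ≠ a.compl := by
  intro h
  have h1 := a.card_inter_compl
  rw [← h, inter_self, a.2] at h1
  omega

/-- A pair of distinct subsets that are not complementary shares its intersection size with
another pair in the same row. -/
theorem exists_ne_card_inter_eq {k : ℕ} {a b : HalfSubset k} (hab : a ≠ b)
    (h0 : #(a.1 ∩ b.1) ≠ 0) : ∃ c : HalfSubset k, c ≠ b ∧ #(a.1 ∩ c.1) = #(a.1 ∩ b.1) := by
  have hlt : #(a.1 ∩ b.1) < k := lt_of_le_of_ne (card_inter_le a b) (card_inter_eq_iff.not.2 hab)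
  obtain ⟨x, hx⟩ := card_pos.1 (Nat.pos_of_ne_zero h0)
  have hpos : 0 < #(a.1 \ b.1) := by
    rw [card_sdiff_halfSubset]
    omega
  obtain ⟨y, hy⟩ := card_pos.1 hpos
  rw [mem_inter] at hx
  rw [mem_sdiff] at hy
  have hy' : y ∉ b.1.erase x := fun h => hy.2 (mem_of_mem_erase h)
  refine ⟨⟨insert y (b.1.erase x), by
    rw [card_insert_of_notMem hy', card_erase_add_one hx.2, b.2]⟩, ?_, ?_⟩
  · intro h
    exact hy.2 (congrArg Subtype.val h ▸ mem_insert_self y (b.1.erase x))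
  · change #(a.1 ∩ insert y (b.1.erase x)) = _
    rw [inter_insert_of_mem hy.1, card_insert_of_notMem (by simp [hy.2]), inter_erase,
      card_erase_add_one (mem_inter.2 hx)]

/-- An intersection size other than 0 and `k` recurs within a row, which would give two entries of
modulus one there. Only complementary pairs remain, and one such entry determines all of them. -/
theorem hasPSTAt_iff_antipodal {k : ℕ} (hk : 1 ≤ k) (X : SimpleGraph (HalfSubset k))
    [DecidableRel X.Adj] {t : ℝ} {f : Fin (k + 1) → ℂ}
    (hf : transitionMatrix X t = spectralHom hk f) :
    HasPSTAt X t ↔ ∃ γ : ℂ, ‖γ‖ = 1 ∧ transitionMatrix X t = γ • antipodalMatrix k := by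
  obtain ⟨φ, hφ⟩ := exists_spectralHom_apply hk f
  rw [← hf] at hφ
  constructor
  · rintro ⟨a, b, hab, hnorm⟩
    have h0 : #(a.1 ∩ b.1) = 0 := by
      by_contra h0
      obtain ⟨c, hcb, hc⟩ := exists_ne_card_inter_eq hab h0
      have hz := transitionMatrix_eq_zero_of_norm_eq_one X hnorm hcb
      rw [hφ, hc, ← hφ] at hz
      rw [hz, norm_zero] at hnorm
      exact zero_ne_one hnorm
    have hφ0 : ‖φ 0‖ = 1 := by rw [← hnorm, hφ, h0]
    refine ⟨φ 0, hφ0, ?_⟩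
    ext c d
    rw [Matrix.smul_apply, antipodalMatrix, Matrix.of_apply]
    split_ifs with hcd
    · rw [hφ, hcd, smul_eq_mul, mul_one]
    · rw [smul_zero]
      refine transitionMatrix_eq_zero_of_norm_eq_one X (b := c.compl) ?_ ?_
      · rw [hφ, c.card_inter_compl, hφ0]
      · rintro rfl
        exact hcd c.card_inter_compl
  · rintro ⟨γ, hγ, hU⟩
    obtain ⟨a, -, -⟩ := exists_card_inter_eq (k := k) le_rfl
    refine ⟨a, a.compl, a.ne_compl hk, ?_⟩
    rw [hU, Matrix.smul_apply, antipodalMatrix, Matrix.of_apply, if_pos a.card_inter_compl,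
      smul_eq_mul, mul_one, hγ]

theorem eigenvalueShift_zero (k : ℕ) (v : ℕ → ℤ) : eigenvalueShift k v 0 = 0 := by
  refine sum_eq_zero fun j hj => ?_
  rw [mem_Icc] at hj
  rw [Nat.choose_eq_zero_of_lt (by omega)]
  simp

theorem weighted_sum_eq_spectralHom {k : ℕ} (hk : 1 ≤ k) {w v : ℕ → ℤ}
    (hv : ∀ r ∈ Icc 1 k, w r = ∑ j ∈ Icc r k, v j * ((k - r).choose (j - r) : ℤ)) :
    ∑ r ∈ Icc 1 k, (w r : ℂ) • (generalizedJohnsonGraph (2 * k) k r).adjMatrix ℂ =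
      spectralHom hk fun m => (eigenvalueShift k v m : ℂ) -
        ∑ j ∈ Icc 1 k, (v j : ℂ) * (k.choose j : ℂ) := by
  rw [weighted_sum_eq_inclusionGram hv, ← map_one (spectralHom hk)]
  have hsum : ∑ j ∈ Icc 1 k, (v j : ℂ) • inclusionGram k j =
      spectralHom hk (∑ j ∈ Icc 1 k, (v j : ℂ) •
        fun m : Fin (k + 1) => inclusionEigenvalue j m) := by
    rw [map_sum]
    refine sum_congr rfl fun j hj => ?_
    rw [map_smul, spectralHom_inclusionEigenvalue hk (mem_Icc.1 hj).2]
  rw [hsum, ← map_smul, ← map_sub]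
  congr 1
  ext m
  simp [eigenvalueShift, inclusionEigenvalue]

theorem transitionMatrix_eq_spectralHom {k : ℕ} (hk : 1 ≤ k) (X : SimpleGraph (HalfSubset k))
    [DecidableRel X.Adj] (t : ℝ) {g : Fin (k + 1) → ℂ} (hX : X.adjMatrix ℂ = spectralHom hk g) :
    transitionMatrix X t =
      spectralHom hk fun m => Complex.exp (-(Complex.I * (t : ℂ)) * g m) := by
  unfold transitionMatrix
  rw [hX, ← map_smul, spectralHom_exp]
  rfl

theorem exp_neg_I_mul_eq_neg_one_pow_iff (t : ℝ) (x : ℤ) (m : ℕ) :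
    Complex.exp (-(Complex.I * (t : ℂ)) * x) = (-1) ^ m ↔
      ∃ n : ℤ, t / Real.pi * x = m + 2 * n := by
  have hm : (-1 : ℂ) ^ m = Complex.exp (m * (Real.pi * Complex.I)) := by
    rw [Complex.exp_nat_mul, Complex.exp_pi_mul_I]
  have hpi : (Real.pi : ℝ) ≠ 0 := Real.pi_ne_zero
  have hpi' : (Real.pi : ℂ) ≠ 0 := by exact_mod_cast hpi
  rw [hm, Complex.exp_eq_exp_iff_exists_int]
  constructor
  · rintro ⟨n, hn⟩
    refine ⟨-m - n, ?_⟩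
    have h : (t : ℂ) * x = -(m * Real.pi) - n * (2 * Real.pi) := by
      apply mul_left_cancel₀ Complex.I_ne_zero
      linear_combination -hn
    have h' : t * x = -(m * Real.pi) - n * (2 * Real.pi) := by exact_mod_cast h
    push_cast
    field_simp
    linear_combination h'
  · rintro ⟨n, hn⟩
    refine ⟨-m - n, ?_⟩
    have h' : t * x = (m + 2 * n) * Real.pi := by
      rw [← hn]
      field_simp
    have h : (t : ℂ) * x = (m + 2 * n) * Real.pi := by exact_mod_cast h'
    push_cast
    linear_combination (-Complex.I) * h

theorem hasPSTAt_iff_phase {k : ℕ} (hk : 1 ≤ k) {w v : ℕ → ℤ}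
    (hv : ∀ r ∈ Icc 1 k, w r = ∑ j ∈ Icc r k, v j * ((k - r).choose (j - r) : ℤ))
    (X : SimpleGraph (HalfSubset k)) [DecidableRel X.Adj]
    (hX : X.adjMatrix ℂ =
      ∑ r ∈ Icc 1 k, (w r : ℂ) • (generalizedJohnsonGraph (2 * k) k r).adjMatrix ℂ) (t : ℝ) :
    HasPSTAt X t ↔ ∀ m ≤ k, ∃ n : ℤ, t / Real.pi * eigenvalueShift k v m = m + 2 * n := by
  rw [weighted_sum_eq_spectralHom hk hv] at hX
  have hU := transitionMatrix_eq_spectralHom hk X t hX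
  rw [hasPSTAt_iff_antipodal hk X hU, hU, ← spectralHom_antipodal hk]
  simp_rw [← map_smul, (spectralHom_injective hk).eq_iff, funext_iff, Pi.smul_apply, smul_eq_mul,
    ← exp_neg_I_mul_eq_neg_one_pow_iff, mul_sub, sub_eq_add_neg, Complex.exp_add]
  set c : ℂ := ∑ j ∈ Icc 1 k, (v j : ℂ) * (k.choose j : ℂ) with hc
  -- `δ` is the global phase contributed by the scalar shift of `A`.
  set δ : ℂ := Complex.exp (-(-(Complex.I * (t : ℂ)) * c)) with hδ
  have hδ0 : δ ≠ 0 := Complex.exp_ne_zero _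
  have hδ1 : ‖δ‖ = 1 := by
    have hreal : c = ((∑ j ∈ Icc 1 k, (v j : ℝ) * (k.choose j : ℝ) : ℝ) : ℂ) := by
      rw [hc]
      push_cast
      rfl
    rw [hδ, hreal, show ∀ s : ℝ, -(-(Complex.I * (t : ℂ)) * (s : ℂ)) =
      ((t * s : ℝ) : ℂ) * Complex.I by intro s; push_cast; ring, Complex.norm_exp_ofReal_mul_I]
  constructor
  · rintro ⟨γ, -, h⟩ m hm
    -- Since the shifted eigenvalue at `m = 0` is 0, this gives `γ (-1)^k = δ`, so `γ` is
    -- eliminated.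
    have h0 := h 0
    simp only [Fin.val_zero, eigenvalueShift_zero, Int.cast_zero, mul_zero, Complex.exp_zero,
      one_mul, add_zero] at h0
    have h1 := h ⟨m, by omega⟩
    rw [pow_add, ← mul_assoc, ← h0, mul_comm δ] at h1
    exact mul_right_cancel₀ hδ0 h1
  · intro h
    refine ⟨δ * (-1) ^ k, by simp [hδ1], fun m => ?_⟩
    rw [h m (by omega), pow_add]
    have : ((-1 : ℂ) ^ k) * (-1) ^ k = 1 := by rw [← mul_pow]; simp
    linear_combination (-(δ * (-1) ^ (m : ℕ))) * this

end Transfer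

theorem theorem4p1 (k : ℕ) (hk : 1 ≤ k) (w : ℕ → ℤ)
    (hw : ∀ r ∈ Finset.Icc 1 k, w r = 0 ∨ w r = 1)
    (X : SimpleGraph {s : Finset (Fin (2 * k)) // s.card = k}) [DecidableRel X.Adj]
    (hX : X.adjMatrix ℂ =
      ∑ r ∈ Finset.Icc 1 k, (w r : ℂ) • (generalizedJohnsonGraph (2 * k) k r).adjMatrix ℂ) :
    (HasPST X ↔ ∃ h : ℕ, 1 ≤ h ∧ WeightCondition k w h) ∧
    ∀ h : ℕ, 1 ≤ h → WeightCondition k w h →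
      HasPSTAt X (Real.pi / 2 ^ h) ∧
      ∃ z : ℕ, Odd z ∧ ∀ t : ℝ,
        HasPSTAt X t ↔ ∃ m : ℤ, Odd m ∧ t = m * (Real.pi / (2 ^ h * z)) := by
  obtain ⟨v, hv⟩ := exists_weight_inversion k w
  have hpst := hasPSTAt_iff_phase hk hv X hX
  have hpi : Real.pi ≠ 0 := Real.pi_ne_zero
  have htimes : ∀ h : ℕ, 1 ≤ h → WeightCondition k w h →
      HasPSTAt X (Real.pi / 2 ^ h) ∧
      ∃ z : ℕ, Odd z ∧ ∀ t : ℝ,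
        HasPSTAt X t ↔ ∃ m : ℤ, Odd m ∧ t = m * (Real.pi / (2 ^ h * z)) := by
    intro h hh hcond
    obtain ⟨z, hz, hτ⟩ := exists_odd_phase_iff hk (eigenvalueShift k v) h
      ((weightCondition_iff hk hv h).1 ⟨hh, hcond⟩)
    have hiff : ∀ t : ℝ,
        HasPSTAt X t ↔ ∃ m : ℤ, Odd m ∧ t = m * (Real.pi / (2 ^ h * z)) := by
      intro t
      rw [hpst, hτ]
      refine exists_congr fun n => and_congr_right fun _ => ?_
      rw [div_eq_iff hpi, div_mul_eq_mul_div, mul_div_assoc]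
    -- `π / 2^h` is the odd multiple `z` of `π / (2^h z)`.
    refine ⟨(hiff _).2 ⟨z, by exact_mod_cast hz, ?_⟩, z, hz, hiff⟩
    have hz0 : (z : ℝ) ≠ 0 := by
      have := hz.pos
      positivity
    push_cast
    field_simp
  refine ⟨⟨?_, ?_⟩, htimes⟩
  · rintro ⟨t, -, ht⟩
    obtain ⟨h, hh⟩ := exists_modEq_of_phase hk _ _ ((hpst t).1 ht)
    exact ⟨h, (weightCondition_iff hk hv h).2 hh⟩
  · rintro ⟨h, hh, hcond⟩
    exact ⟨_, by positivity, (htimes h hh hcond).1⟩
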